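/- A curve is the image of a continuous map $[0,1]\to\mathbb{R}^2$. A curve is $x$-monotone if every vertical line intersects it in at most one point, and a grounded $x$-monotone curve is an $x$-monotone curve that is contained in the half-plane $\{x\ge 0\}$ and whose left endpoint lies on the line $\{x=0\}$. The disjointness graph of a family of curves has the curves as its vertices, two of them being joined by an edge if and only if they are disjoint. For every integer $k\geq 2$ there exists a finite family $\mathcal{C}$ of grounded $x$-monotone curves such that the disjointness graph $G$ of $\mathcal{C}$ has clique number $\omega(G)=k$ and chromatic number $\chi(G)=\binom{k+1}{2}$. -/

import Mathlib

/-- A curve in the plane: the image of a continuous map defined on `[0, 1]`. -/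
def IsCurve (C : Set (ℝ × ℝ)) : Prop :=
  ∃ φ : unitInterval → ℝ × ℝ, Continuous φ ∧ Set.range φ = C

/-- A curve is `x`-monotone if every vertical line meets it in at most one point. -/
def IsXMonotoneCurve (C : Set (ℝ × ℝ)) : Prop :=
  IsCurve C ∧ ∀ a : ℝ, (C ∩ {p | p.1 = a}).Subsingleton

/-- `p` is the left endpoint of `C`: a point of `C` whose `x`-coordinate is smallest
(for an `x`-monotone curve there is exactly one such point). -/
def IsLeftEndpoint (C : Set (ℝ × ℝ)) (p : ℝ × ℝ) : Prop :=
  p ∈ C ∧ ∀ q ∈ C, p.1 ≤ q.1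

/-- A grounded `x`-monotone curve: an `x`-monotone curve that is contained in the half-plane
`{x ≥ 0}` and whose left endpoint lies on the vertical line `{x = 0}`. -/
def IsGroundedXMonotoneCurve (C : Set (ℝ × ℝ)) : Prop :=
  IsXMonotoneCurve C ∧ C ⊆ {p | 0 ≤ p.1} ∧ ∃ p, IsLeftEndpoint C p ∧ p.1 = 0

/-- The disjointness graph of a family of sets: the vertices are the members of the family,
and two (different) members are adjacent if and only if they are disjoint. -/
def disjointnessGraph {X : Type*} (𝒞 : Set (Set X)) : SimpleGraph 𝒞 where
  Adj A B := A ≠ B ∧ Disjoint (A : Set X) (B : Set X)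
  symm := ⟨fun _ _ h => ⟨h.1.symm, h.2.symm⟩⟩
  loopless := ⟨fun _ h => h.1 rfl⟩

/-! ### Realising ordered graphs by grounded `x`-monotone curves -/

section Realization

variable {V : Type*}

/-! Two independent constructions meet here. `exists_family_iso` realises every length-transitive
graph: curves start at heights `p`, the vertex `j` ends at an abscissa increasing with `L j`, and
each pair gets its own abscissa, before either of its curves ends, where a non-adjacent pair is made
to cross. The shorter curve moves and drags its neighbours on the side it moves to, so that adjacent
curves keep their vertical order.

`exists_lengthTransitive_graph` builds the extremal graphs by induction. Passing from `k` to `k + 1`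
adds `k + 1` colours but only one to the clique number: by Hall's theorem some transversal of the
new cliques is rainbow, and the copy of the old graph joined to it must avoid all its colours. -/

open Classical in
/-- The displacement of the vertex `j` that makes `a` and `b` meet: if `b` is the shorter one, then
`b` and its lower neighbours move down, otherwise `a` and its upper neighbours move up. -/
noncomputable def shift (G : SimpleGraph V) (p : V → ℝ) (L : V → ℕ) (q : V × V) (j : V) : ℝ :=
  if L q.2 ≤ L q.1 then
    if j = q.2 ∨ (p j < p q.2 ∧ G.Adj j q.2) then p q.1 - p q.2 else 0
  else
    if j = q.1 ∨ (p q.1 < p j ∧ G.Adj q.1 j) then p q.2 - p q.1 else 0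

/-- A graph on vertices with heights `p` and lengths `L` is length-transitive if two consecutive
edges of a height-increasing path can only fail to be shortcut when their common vertex is strictly
the shortest of the three. -/
def LengthTransitive {α : Type*} [LT α] (G : SimpleGraph V) (p : V → α) (L : V → ℕ) : Prop :=
  ∀ ⦃a b c⦄, p a < p b → p b < p c → G.Adj a b → G.Adj b c → (L a ≤ L b ∨ L c ≤ L b) → G.Adj a c

theorem shift_meet {G : SimpleGraph V} {p : V → ℝ} {L : V → ℕ} {a b : V} (hab : p a < p b)
    (h : ¬ G.Adj a b) : p a + shift G p L (a, b) a = p b + shift G p L (a, b) b := by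
  have hne : a ≠ b := fun e => by simp [e] at hab
  unfold shift
  split_ifs <;> simp_all

/-- When `q.2` is pulled down, the only danger is that `j` moves and `i` does not. But `j` is at
least as long as `q.2`, so length-transitivity at `j` makes `i` a lower neighbour of `q.2` too, and
both move equally. The upward case is symmetric, with the path through `i`. -/
theorem shift_mono {G : SimpleGraph V} {p : V → ℝ} {L : V → ℕ} (hG : LengthTransitive G p L)
    {q : V × V} (hq : p q.1 < p q.2) {i j : V} (hij : p i < p j) (h : G.Adj i j)
    (hi : min (L q.1) (L q.2) ≤ L i) (hj : min (L q.1) (L q.2) ≤ L j) :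
    shift G p L q i ≤ shift G p L q j := by
  unfold shift
  by_cases hL : L q.2 ≤ L q.1
  · rw [min_eq_right hL] at hi hj
    simp only [if_pos hL]
    by_cases hj' : j = q.2 ∨ (p j < p q.2 ∧ G.Adj j q.2)
    · have : i = q.2 ∨ (p i < p q.2 ∧ G.Adj i q.2) := by
        rcases hj' with rfl | ⟨h1, h2⟩
        · exact Or.inr ⟨hij, h⟩
        · exact Or.inr ⟨hij.trans h1, hG hij h1 h h2 (Or.inr hj)⟩
      rw [if_pos hj', if_pos this]
    · rw [if_neg hj']
      split_ifs
      · linarith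
      · rfl
  · rw [min_eq_left (le_of_not_ge hL)] at hi hj
    simp only [if_neg hL]
    by_cases hi' : i = q.1 ∨ (p q.1 < p i ∧ G.Adj q.1 i)
    · have : j = q.1 ∨ (p q.1 < p j ∧ G.Adj q.1 j) := by
        rcases hi' with rfl | ⟨h1, h2⟩
        · exact Or.inr ⟨hij, h⟩
        · exact Or.inr ⟨h1.trans hij, hG h1 hij h2 h (Or.inl hi)⟩
      rw [if_pos hi', if_pos this]
    · rw [if_neg hi']
      split_ifs
      · linarith
      · rfl

variable [Fintype V]

/-- The time at which the pair `q` is made to meet. -/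
noncomputable def meetTime (L : V → ℕ) (q : V × V) : ℕ :=
  Fintype.card (V × V) * min (L q.1) (L q.2) + Fintype.equivFin (V × V) q + 1

theorem meetTime_injective (L : V → ℕ) : Function.Injective (meetTime L) := by
  intro q r h
  have := congrArg (· % Fintype.card (V × V)) (Nat.succ_injective h)
  simp only [Nat.mul_add_mod, Nat.mod_eq_of_lt (Fin.is_lt _)] at this
  exact (Fintype.equivFin (V × V)).injective (Fin.ext this)

/-- The abscissa at which the curve of the vertex `j` ends. -/
def endTime (L : V → ℕ) (j : V) : ℕ :=
  Fintype.card (V × V) * (L j + 1)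

/-- Time is cut into blocks of length `Fintype.card (V × V)`. The pair `q` meets in the block
numbered by its smaller length, and a curve lasts to the end of the block of its own length. -/
theorem meetTime_le_endTime {L : V → ℕ} {q : V × V} {j : V} (h : min (L q.1) (L q.2) ≤ L j) :
    meetTime L q ≤ endTime L j := by
  have h2 := (Fintype.equivFin (V × V) q).is_lt
  have h3 := Nat.mul_le_mul_left (Fintype.card (V × V)) h
  unfold meetTime endTime
  rw [mul_add]
  omega

theorem endTime_lt_meetTime {L : V → ℕ} {q : V × V} {j : V}
    (h : L j < min (L q.1) (L q.2)) : endTime L j < meetTime L q :=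
  Nat.lt_succ_of_le ((Nat.mul_le_mul_left _ h).trans (Nat.le_add_right _ _))

/-- The tent function of height one on the interval `[t - 1, t + 1]`. -/
noncomputable def tent (t x : ℝ) : ℝ := max 0 (1 - |x - t|)

open Classical in
/-- The height of the curve of the vertex `j` at abscissa `x`. -/
noncomputable def height (G : SimpleGraph V) (p : V → ℝ) (L : V → ℕ) (j : V) (x : ℝ) : ℝ :=
  p j + ∑ q : V × V, if p q.1 < p q.2 then tent (meetTime L q) x * shift G p L q j else 0

theorem continuous_height (G : SimpleGraph V) (p : V → ℝ) (L : V → ℕ) (j : V) :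
    Continuous (height G p L j) := by
  unfold height tent
  refine continuous_const.add (continuous_finsetSum _ fun q _ => ?_)
  split_ifs <;> fun_prop

theorem height_lt {G : SimpleGraph V} {p : V → ℝ} {L : V → ℕ} (hG : LengthTransitive G p L)
    {i j : V} (hij : p i < p j) (h : G.Adj i j) {x : ℝ} (hi : x ≤ endTime L i)
    (hj : x ≤ endTime L j) : height G p L i x < height G p L j x := by
  refine add_lt_add_of_lt_of_le hij (Finset.sum_le_sum fun q _ => ?_)
  split_ifs with hq
  -- A curve too short for `shift_mono` ends at least one unit before the meeting time, where the
  -- tent still vanishes.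
  · have early : ∀ v, x ≤ endTime L v → L v < min (L q.1) (L q.2) →
        tent (meetTime L q) x = 0 := fun v hv hlt => by
      have : (endTime L v : ℝ) + 1 ≤ meetTime L q := by exact_mod_cast endTime_lt_meetTime hlt
      refine max_eq_left ?_
      linarith [neg_le_abs (x - (meetTime L q : ℝ))]
    by_cases h1 : L i < min (L q.1) (L q.2)
    · simp [early i hi h1]
    by_cases h2 : L j < min (L q.1) (L q.2)
    · simp [early j hj h2]
    exact mul_le_mul_of_nonneg_left (shift_mono hG hq hij h (not_lt.1 h1) (not_lt.1 h2))
      (le_max_left _ _)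
  · rfl

theorem tent_natCast {m n : ℕ} (h : m ≠ n) : tent m n = 0 := by
  refine max_eq_left ?_
  have : (1 : ℤ) ≤ |(n : ℤ) - m| := Int.one_le_abs (by omega)
  have : (1 : ℝ) ≤ |(n : ℝ) - m| := by exact_mod_cast this
  linarith

theorem height_meetTime {G : SimpleGraph V} {p : V → ℝ} {L : V → ℕ} {q : V × V}
    (hq : p q.1 < p q.2) (j : V) :
    height G p L j (meetTime L q) = p j + shift G p L q j := by
  unfold height
  rw [Finset.sum_eq_single q]
  · simp [hq, tent]
  · intro r _ hr
    rw [tent_natCast ((meetTime_injective L).ne hr)]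
    simp
  · simp

/-- The curve of the vertex `j`. -/
def curve (G : SimpleGraph V) (p : V → ℝ) (L : V → ℕ) (j : V) : Set (ℝ × ℝ) :=
  (fun x => (x, height G p L j x)) '' Set.Icc 0 (endTime L j)

theorem isGroundedXMonotoneCurve_curve (G : SimpleGraph V) (p : V → ℝ) (L : V → ℕ) (j : V) :
    IsGroundedXMonotoneCurve (curve G p L j) := by
  have h0 : (0 : ℝ) ≤ endTime L j := Nat.cast_nonneg _
  refine ⟨⟨⟨fun s => (endTime L j * s, height G p L j (endTime L j * s)), ?_, ?_⟩, ?_⟩, ?_,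
    (0, height G p L j 0), ⟨⟨0, ⟨le_rfl, h0⟩, rfl⟩, ?_⟩, rfl⟩
  · have := continuous_height G p L j
    fun_prop
  · ext y
    constructor
    · rintro ⟨s, rfl⟩
      exact ⟨_, ⟨mul_nonneg h0 s.2.1, mul_le_of_le_one_right h0 s.2.2⟩, rfl⟩
    · rintro ⟨x, ⟨hx0, hx1⟩, rfl⟩
      rcases h0.eq_or_lt with h | h
      · refine ⟨0, ?_⟩
        have : x = 0 := le_antisymm (h ▸ hx1) hx0
        simp [this]
      · refine ⟨⟨x / endTime L j, by positivity, (div_le_one h).2 hx1⟩, ?_⟩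
        simp [mul_div_cancel₀ _ h.ne']
  · rintro a _ ⟨⟨x, _, rfl⟩, hx⟩ _ ⟨⟨y, _, rfl⟩, hy⟩
    obtain rfl : x = a := hx
    obtain rfl : y = x := hy
    rfl
  · rintro _ ⟨x, hx, rfl⟩
    exact hx.1
  · rintro _ ⟨x, hx, rfl⟩
    exact hx.1

theorem disjoint_curve_iff {G : SimpleGraph V} {p : V → ℝ} {L : V → ℕ}
    (hG : LengthTransitive G p L) {a b : V} (hab : p a < p b) :
    Disjoint (curve G p L a) (curve G p L b) ↔ G.Adj a b := by
  constructor
  · intro hd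
    by_contra hn
    refine absurd hd (Set.not_disjoint_iff.2
      ⟨((meetTime L (a, b) : ℝ), height G p L a (meetTime L (a, b))),
        ⟨_, ⟨Nat.cast_nonneg _, Nat.cast_le.2 (meetTime_le_endTime (q := (a, b)) (min_le_left _ _))⟩,
          rfl⟩,
        ⟨_, ⟨Nat.cast_nonneg _, Nat.cast_le.2 (meetTime_le_endTime (q := (a, b)) (min_le_right _ _))⟩,
          ?_⟩⟩)
    refine Prod.ext rfl ?_
    change height G p L b (meetTime L (a, b)) = height G p L a (meetTime L (a, b))
    rw [height_meetTime (q := (a, b)) hab, height_meetTime (q := (a, b)) hab, shift_meet hab hn]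
  · intro h
    refine Set.disjoint_left.2 ?_
    rintro _ ⟨x, hx, rfl⟩ ⟨y, hy, he⟩
    obtain ⟨rfl, he⟩ := Prod.mk.inj he
    exact (height_lt hG hab h hx.2 hy.2).ne' he

theorem height_zero (G : SimpleGraph V) (p : V → ℝ) (L : V → ℕ) (j : V) :
    height G p L j 0 = p j := by
  unfold height
  rw [Finset.sum_eq_zero fun q _ => ?_, add_zero]
  have := tent_natCast (m := meetTime L q) (n := 0) (Nat.succ_ne_zero _)
  rw [Nat.cast_zero] at this
  simp [this]

theorem curve_injective (G : SimpleGraph V) {p : V → ℝ} (hp : Function.Injective p) (L : V → ℕ) :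
    Function.Injective (curve G p L) := by
  intro i j h
  have hi : (0, height G p L i 0) ∈ curve G p L j := h ▸ ⟨0, ⟨le_rfl, Nat.cast_nonneg _⟩, rfl⟩
  obtain ⟨x, _, hx⟩ := hi
  obtain ⟨rfl, hx⟩ := Prod.mk.inj hx
  rw [height_zero, height_zero] at hx
  exact (hp hx).symm

theorem exists_family_iso {G : SimpleGraph V} {p : V → ℕ} {L : V → ℕ}
    (hp : ∀ a b, G.Adj a b → p a ≠ p b) (hG : LengthTransitive G p L) :
    ∃ 𝒞 : Set (Set (ℝ × ℝ)), 𝒞.Finite ∧ (∀ C ∈ 𝒞, IsGroundedXMonotoneCurve C) ∧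
      Nonempty (G ≃g disjointnessGraph 𝒞) := by
  -- Distinct perturbations in `[0, 1)` separate equal heights without changing the order along
  -- edges, whose ends have distinct integer heights.
  let δ : V → ℝ := fun v => (Fintype.equivFin V v : ℕ) / (Fintype.card V : ℝ)
  have card_pos (v : V) : (0 : ℝ) < Fintype.card V := by
    exact_mod_cast Fintype.card_pos_iff.2 ⟨v⟩
  have δ_nonneg (v : V) : 0 ≤ δ v := by positivity
  have δ_lt (v : V) : δ v < 1 := (div_lt_one (card_pos v)).2 (Nat.cast_lt.2 (Fin.is_lt _))
  let r : V → ℝ := fun v => p v + δ v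
  have hr : Function.Injective r := by
    intro v w h
    have := congrArg Int.fract h
    simp only [r, Int.fract_natCast_add, Int.fract_eq_self.2 ⟨δ_nonneg _, δ_lt _⟩] at this
    have := (div_left_inj' (card_pos v).ne').1 this
    exact (Fintype.equivFin V).injective (Fin.ext (Nat.cast_injective this))
  have lt_of_adj {a b : V} (h : G.Adj a b) (hab : r a < r b) : p a < p b := by
    refine (hp a b h).lt_or_gt.resolve_right fun hlt => ?_
    have : (p b : ℝ) + 1 ≤ p a := by exact_mod_cast hlt
    have h1 := δ_lt b
    have h2 := δ_nonneg a
    simp only [r] at hab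
    linarith
  have hGr : LengthTransitive G r L := fun a b c hab hbc h h' =>
    hG (lt_of_adj h hab) (lt_of_adj h' hbc) h h'
  have hC := curve_injective G hr L
  refine ⟨Set.range (curve G r L), Set.finite_range _, ?_, ⟨⟨Equiv.ofInjective _ hC, ?_⟩⟩⟩
  · rintro _ ⟨v, rfl⟩
    exact isGroundedXMonotoneCurve_curve G r L v
  · intro a b
    change ((Equiv.ofInjective _ hC a ≠ Equiv.ofInjective _ hC b) ∧
      Disjoint (curve G r L a) (curve G r L b)) ↔ G.Adj a b
    rw [(Equiv.ofInjective _ hC).injective.ne_iff]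
    constructor
    · rintro ⟨hne, hd⟩
      rcases (hr.ne hne).lt_or_gt with h | h
      · exact (disjoint_curve_iff hGr h).1 hd
      · exact ((disjoint_curve_iff hGr h).1 hd.symm).symm
    · intro hadj
      refine ⟨hadj.ne, ?_⟩
      rcases (hr.ne hadj.ne).lt_or_gt with h | h
      · exact (disjoint_curve_iff hGr h).2 hadj
      · exact ((disjoint_curve_iff hGr h).2 hadj.symm).symm

end Realization

/-! ### The extremal graphs -/

section Extremal

variable {V : Type} {n : ℕ}

/-- `n` disjoint cliques of size `n`, together with one copy of `G` for each transversal of these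
cliques, completely joined to it. -/
def transversalGraph (n : ℕ) (G : SimpleGraph V) :
    SimpleGraph ((Fin n × Fin n) ⊕ ((Fin n → Fin n) × V)) where
  Adj
    | .inl a, .inl b => a.1 = b.1 ∧ a.2 ≠ b.2
    | .inl a, .inr b => b.1 a.1 = a.2
    | .inr a, .inl b => a.1 b.1 = b.2
    | .inr a, .inr b => a.1 = b.1 ∧ G.Adj a.2 b.2
  symm := ⟨by
    rintro (a | a) (b | b) h
    · exact ⟨h.1.symm, h.2.symm⟩
    · exact h
    · exact h
    · exact ⟨h.1.symm, h.2.symm⟩⟩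
  loopless := ⟨by
    rintro (a | a) h
    · exact h.2 rfl
    · exact h.2.ne rfl⟩

/-- The position of a vertex: the cliques come first. -/
def transversalPos (n : ℕ) (p : V → ℕ) : (Fin n × Fin n) ⊕ ((Fin n → Fin n) × V) → ℕ
  | .inl a => a.2
  | .inr b => n + p b.2

/-- The length of a vertex: the cliques are short, with decreasing lengths. -/
def transversalLength (n : ℕ) (L : V → ℕ) : (Fin n × Fin n) ⊕ ((Fin n → Fin n) × V) → ℕ
  | .inl a => n - a.2
  | .inr b => n + 1 + L b.2

variable {G : SimpleGraph V}

theorem transversalPos_ne {p : V → ℕ} (hp : ∀ a b, G.Adj a b → p a ≠ p b) :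
    ∀ a b, (transversalGraph n G).Adj a b → transversalPos n p a ≠ transversalPos n p b := by
  rintro (a | a) (b | b) h
  · exact Fin.val_injective.ne h.2
  · have := a.2.is_lt
    simp only [transversalPos]
    omega
  · have := b.2.is_lt
    simp only [transversalPos]
    omega
  · have := hp _ _ h.2
    simp only [transversalPos]
    omega

/-- The only new paths that may lack a shortcut go from a clique vertex to a higher one of the same
clique, then into a copy of `G`. Lengths decrease up the clique and copies are longer, so the middle
vertex is strictly shortest. -/
theorem LengthTransitive.transversalGraph {p L : V → ℕ} (hG : LengthTransitive G p L) :
    LengthTransitive (transversalGraph n G) (transversalPos n p) (transversalLength n L) := by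
  rintro (a | a) (b | b) (c | c) hab hbc h h' hL <;>
    simp only [transversalPos, transversalLength] at hab hbc hL
  · exact ⟨h.1.trans h'.1, fun e => by rw [e] at hab; omega⟩
  · omega
  · omega
  · exact (congrFun h'.1 a.1).symm.trans h
  · omega
  · omega
  · omega
  · exact ⟨h.1.trans h'.1, hG (by omega) (by omega) h.2 h'.2 (by omega)⟩

/-- A clique meeting a copy of `G` stays in that copy apart from vertices of its transversal, which
are pairwise non-adjacent, so it has at most one of them. -/
theorem card_le_of_isClique_transversalGraph {k : ℕ} (hn : n ≤ k + 1)
    (hG : ∀ s : Finset V, G.IsClique s → s.card ≤ k)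
    (s : Finset ((Fin n × Fin n) ⊕ ((Fin n → Fin n) × V)))
    (hs : (transversalGraph n G).IsClique s) : s.card ≤ k + 1 := by
  rw [← Finset.card_toLeft_add_card_toRight]
  rcases s.toRight.eq_empty_or_nonempty with he | ⟨⟨N, v⟩, hN⟩
  · rw [he, Finset.card_empty, add_zero]
    refine (Finset.card_le_card_of_injOn (t := (Finset.univ : Finset (Fin n))) Prod.snd
      (fun _ _ => Finset.mem_univ _) ?_).trans (by simpa using hn)
    intro a ha b hb hab
    by_contra hne
    exact (hs (Finset.mem_toLeft.1 ha) (Finset.mem_toLeft.1 hb) (Sum.inl_injective.ne hne)).2 hab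
  · have hNs := Finset.mem_toRight.1 hN
    have fst_eq : ∀ b ∈ s.toRight, b.1 = N := fun b hb => by
      by_contra hne
      exact hne (hs (Finset.mem_toRight.1 hb) hNs
        (Sum.inr_injective.ne fun e => hne (by rw [e]))).1
    have hl : s.toLeft.card ≤ 1 := by
      refine Finset.card_le_one.2 fun a ha b hb => ?_
      have h1 : N a.1 = a.2 := hs (Finset.mem_toLeft.1 ha) hNs Sum.inl_ne_inr
      have h2 : N b.1 = b.2 := hs (Finset.mem_toLeft.1 hb) hNs Sum.inl_ne_inr
      by_contra hne
      have h3 := hs (Finset.mem_toLeft.1 ha) (Finset.mem_toLeft.1 hb) (Sum.inl_injective.ne hne)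
      exact h3.2 (by rw [← h1, ← h2, h3.1])
    have hr : s.toRight.card ≤ k := by
      classical
      have hinj : Set.InjOn Prod.snd (s.toRight : Set ((Fin n → Fin n) × V)) := fun a ha b hb h =>
        Prod.ext ((fst_eq a ha).trans (fst_eq b hb).symm) h
      rw [← Finset.card_image_of_injOn hinj]
      refine hG _ ?_
      simp only [Finset.coe_image]
      rintro _ ⟨a, ha, rfl⟩ _ ⟨b, hb, rfl⟩ hne
      exact (hs (Finset.mem_toRight.1 ha) (Finset.mem_toRight.1 hb)
        (Sum.inr_injective.ne fun e => hne (by rw [e]))).2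
    omega

theorem exists_isNClique_transversalGraph (hn : 0 < n) :
    ∃ s, (transversalGraph n G).IsNClique n s := by
  let f : Fin n ↪ (Fin n × Fin n) ⊕ ((Fin n → Fin n) × V) :=
    ⟨fun j => .inl (⟨0, hn⟩, j), fun a b h => (Prod.mk.inj (Sum.inl_injective h)).2⟩
  refine ⟨Finset.univ.map f, ?_, by simp⟩
  simp only [Finset.coe_map, Finset.coe_univ, Set.image_univ]
  rintro _ ⟨a, rfl⟩ _ ⟨b, rfl⟩ hne
  exact ⟨rfl, fun e => hne (congrArg f e)⟩

theorem colorable_transversalGraph {m : ℕ} (hG : G.Colorable m) :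
    (transversalGraph n G).Colorable (n + m) := by
  obtain ⟨c⟩ := hG
  have c' : (transversalGraph n G).Coloring (Fin n ⊕ Fin m) :=
    SimpleGraph.Coloring.mk (Sum.map Prod.snd fun b => c b.2) (by
      rintro (a | a) (b | b) h
      · exact Sum.inl_injective.ne h.2
      · exact Sum.inl_ne_inr
      · exact Sum.inr_ne_inl
      · exact Sum.inr_injective.ne (c.valid h.2))
  simpa using c'.colorable

theorem le_card_image_transversalGraph [Fintype V] {m : ℕ}
    (hG : ∀ c : G.Coloring ℕ, m ≤ (Finset.univ.image c).card)
    (c : (transversalGraph n G).Coloring ℕ) : n + m ≤ (Finset.univ.image c).card := by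
  have hinj (i : Fin n) : Function.Injective fun j : Fin n => c (.inl (i, j)) := fun a b h => by
    by_contra hne
    exact c.valid (v := .inl (i, a)) (w := .inl (i, b)) ⟨rfl, hne⟩ h
  -- Hall's condition is immediate: each of the `n` cliques already shows `n` colours.
  obtain ⟨f, hf, hmem⟩ := (Finset.all_card_le_biUnion_card_iff_exists_injective
    fun i : Fin n => Finset.univ.image fun j : Fin n => c (.inl (i, j))).1 fun s => by
      rcases s.eq_empty_or_nonempty with rfl | ⟨i, hi⟩
      · simp
      · refine le_trans ?_ (Finset.card_le_card (Finset.subset_biUnion_of_mem _ hi))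
        rw [Finset.card_image_of_injective _ (hinj i)]
        exact Finset.card_le_univ s
  simp only [Finset.mem_image, Finset.mem_univ, true_and] at hmem
  choose N hN using hmem
  let d : G.Coloring ℕ := SimpleGraph.Coloring.mk (fun v => c (.inr (N, v))) fun {v w} h =>
    c.valid (v := .inr (N, v)) (w := .inr (N, w)) ⟨rfl, h⟩
  have hdisj : Disjoint (Finset.univ.image f) (Finset.univ.image d) := by
    simp only [Finset.disjoint_left, Finset.mem_image, Finset.mem_univ, true_and]
    rintro _ ⟨i, rfl⟩ ⟨v, hv⟩
    exact c.valid (v := .inl (i, N i)) (w := .inr (N, v)) rfl ((hN i).trans hv.symm)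
  calc n + m ≤ (Finset.univ.image f).card + (Finset.univ.image d).card := by
        rw [Finset.card_image_of_injective _ hf, Finset.card_univ, Fintype.card_fin]
        exact Nat.add_le_add_left (hG d) _
    _ = (Finset.univ.image f ∪ Finset.univ.image d).card :=
        (Finset.card_union_of_disjoint hdisj).symm
    _ ≤ _ := by
        refine Finset.card_le_card (Finset.union_subset ?_ ?_)
        · rintro _ h
          obtain ⟨i, _, rfl⟩ := Finset.mem_image.1 h
          exact Finset.mem_image.2 ⟨.inl (i, N i), Finset.mem_univ _, hN i⟩
        · rintro _ h
          obtain ⟨v, _, rfl⟩ := Finset.mem_image.1 h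
          exact Finset.mem_image.2 ⟨.inr (N, v), Finset.mem_univ _, rfl⟩

theorem exists_lengthTransitive_graph (k : ℕ) :
    ∃ (V : Type) (_ : Fintype V) (G : SimpleGraph V) (p L : V → ℕ),
      (∀ a b, G.Adj a b → p a ≠ p b) ∧ LengthTransitive G p L ∧
      (∀ s : Finset V, G.IsClique s → s.card ≤ k) ∧ (∃ s, G.IsNClique k s) ∧
      G.Colorable ((k + 1).choose 2) ∧
      ∀ c : G.Coloring ℕ, (k + 1).choose 2 ≤ (Finset.univ.image c).card := by
  induction k with
  | zero =>
    refine ⟨Empty, inferInstance, ⊥, fun _ => 0, fun _ => 0, fun a => a.elim, fun a => a.elim,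
      fun s _ => ?_, ⟨∅, by simp⟩, ⟨SimpleGraph.Coloring.mk (fun a => a.elim) fun {a} => a.elim⟩,
      fun _ => by simp⟩
    simp [Finset.eq_empty_of_isEmpty s]
  | succ k ih =>
    obtain ⟨V, _, G, p, L, hp, hG, hle, -, hcol, hge⟩ := ih
    have hchoose : (k + 1 + 1).choose 2 = (k + 1) + (k + 1).choose 2 := by
      rw [Nat.choose_succ_succ' (k + 1) 1, Nat.choose_one_right]
    rw [hchoose]
    exact ⟨_, inferInstance, transversalGraph (k + 1) G, _, _, transversalPos_ne hp,
      hG.transversalGraph, card_le_of_isClique_transversalGraph le_rfl hle,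
      exists_isNClique_transversalGraph k.succ_pos, colorable_transversalGraph hcol,
      le_card_image_transversalGraph hge⟩

end Extremal

/-! ### Transfer of the invariants to the disjointness graph -/

theorem SimpleGraph.Iso.exists_isNClique {V W : Type*} {G : SimpleGraph V} {H : SimpleGraph W}
    (e : G ≃g H) {n : ℕ} (h : ∃ s, G.IsNClique n s) : ∃ s, H.IsNClique n s := by
  obtain ⟨s, hs⟩ := h
  refine ⟨s.map e.toEquiv.toEmbedding, ?_, by simpa using hs.card_eq⟩
  simp only [Finset.coe_map]
  rintro _ ⟨a, ha, rfl⟩ _ ⟨b, hb, rfl⟩ hne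
  exact e.map_adj_iff.2 (hs.isClique ha hb fun h => hne (by rw [h]))

theorem SimpleGraph.Iso.cliqueNum_eq {V W : Type*} {G : SimpleGraph V} {H : SimpleGraph W}
    (e : G ≃g H) : G.cliqueNum = H.cliqueNum :=
  congrArg sSup (Set.ext fun _ => ⟨e.exists_isNClique, e.symm.exists_isNClique⟩)

theorem theorem2 (k : ℕ) (hk : 2 ≤ k) :
    ∃ 𝒞 : Set (Set (ℝ × ℝ)),
      𝒞.Finite ∧
      (∀ C ∈ 𝒞, IsGroundedXMonotoneCurve C) ∧
      (disjointnessGraph 𝒞).cliqueNum = k ∧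
      (disjointnessGraph 𝒞).chromaticNumber = (((k + 1).choose 2 : ℕ) : ℕ∞) := by
  obtain ⟨V, _, G, p, L, hp, hG, hle, ⟨s, hs⟩, hcol, hge⟩ := exists_lengthTransitive_graph k
  obtain ⟨𝒞, hfin, hgr, ⟨e⟩⟩ := exists_family_iso hp hG
  refine ⟨𝒞, hfin, hgr, ?_, ?_⟩
  · rw [← e.cliqueNum_eq]
    refine le_antisymm ?_ ?_
    · obtain ⟨t, ht⟩ := G.exists_isNClique_cliqueNum
      exact ht.card_eq ▸ hle t ht.isClique
    · exact hs.card_eq ▸ SimpleGraph.IsClique.card_le_cliqueNum (tc := hs.isClique)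
  · rw [← SimpleGraph.chromaticNumber_congr e]
    refine le_antisymm hcol.chromaticNumber_le
      (SimpleGraph.le_chromaticNumber_iff_coloring.2 fun m c => ?_)
    let d : G.Coloring ℕ := SimpleGraph.Coloring.mk (fun v => (c v : ℕ)) fun h =>
      Fin.val_injective.ne (c.valid h)
    refine Nat.cast_le.2 ((hge d).trans ?_)
    calc (Finset.univ.image d).card ≤ (Finset.range m).card := Finset.card_le_card fun x hx => by
          obtain ⟨v, _, rfl⟩ := Finset.mem_image.1 hx
          exact Finset.mem_range.2 (c v).is_lt
      _ = m := Finset.card_range m
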